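/- **Setting.** Let $G=(V,E)$ be a finite, nonempty, strongly connected digraph (unweighted; loops are permitted) with $0$–$1$ adjacency matrix $A$, where $a_{ij}=1$ iff $(i,j)\in E$. Let $d_i^{out}=\#\{j:(i,j)\in E\}$ and $d_i^{in}=\#\{j:(j,i)\in E\}$. Write $\rho(M)$ for the spectral radius of a matrix $M$. A nonnegative matrix is *primitive* if its eigenvalues, counted with algebraic multiplicity, can be listed as $\lambda_1,\dots,\lambda_n$ with $\lambda_1$ real and $\lambda_1>|\lambda_k|$ for $k\ge 2$. Let $\mathcal P$ be the class of functions $f(z)=\sum_{k\ge0}c_kz^k$ with all $c_k>0$ and radius of convergence $R_f\in(0,\infty]$. Let $\mathcal P_\infty$ be the set of $f\in\mathcal P$ with $R_f=\infty$, and $\mathcal P^\infty$ the set of $f\in\mathcal P$ with $R_f<\infty$ and $\sum_k c_kR_f^k=\infty$. For a square matrix $M$ put $f(M)=\sum_k c_kM^k$ and $t^*_M=R_f/\rho(M)$ (which is $\infty$ if $R_f=\infty$ or $\rho(M)=0$). For $v\in\mathbb R^V$, the broadcast and receive total $f$-communicabilities with preference vector $v$ are $\mathbf{TC}^b_{M,v}(t)=f(tM)v$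 and $\mathbf{TC}^r_{M,v}(t)=f(tM^T)v$. Let $\mathbf 1$ be the vector of all ones. As $t$ tends to a limit, the rankings produced by scores $s(t)\in\mathbb R^V$ are said to *converge to those produced by* $w\in\mathbb R^V$ if $w_i<w_j$ implies $s_i(t)<s_j(t)$ for all $t$ sufficiently near the limit and, moreover, there are $a(t)>0$ and $b(t)\in\mathbb R$, the same for all nodes, with $a(t)s_i(t)+b(t)\to w_i$ for every $i$. They converge *without shift* if one can take $b(t)=0$. **Theorem.** Let $f\in\mathcal P$. Then $f(tA)$ and $f(tA^T)$ converge for $0<t<t^*_A$, and: 1. as $t\to0+$, the rankings produced by $\mathbf{TC}^b_{A,\mathbf 1}(t)$ converge to those produced by the out-degrees; 2. as $t\to0+$, the rankings produced by $\mathbf{TC}^r_{A,\mathbf 1}(t)$ converge to those produced by the in-degrees. There are entrywise positive vectors $x_1,y_1$ with $Ax_1=\rho(A)x_1$ and $y_1^TA=\rho(A)y_1^T$ (dominant right and left eigenvectors of $A$). Suppose further that $f\in\mathcal P_\infty\cup\mathcal P^\infty$, and let $M$ be either - $M=A$, provided that $A$ is primitive, or - $M=A_\varepsilon:=(1-\varepsilon)A+\varepsilon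 I$ for some $\varepsilon\in(0,1)$ (with $A$ not necessarily primitive). Then $f(tM)$ and $f(tM^T)$ converge for $0<t<t^*_M$, and for all such $x_1,y_1$, as $t\to t^*_M-$ (that is, $t\to\infty$ if $t^*_M=\infty$): 3. the rankings produced by $\mathbf{TC}^b_{M,\mathbf 1}(t)$ converge, without shift, to those produced by $x_1$; 4. the rankings produced by $\mathbf{TC}^r_{M,\mathbf 1}(t)$ converge, without shift, to those produced by $y_1$; 5. statements 3 and 4 remain true with $\mathbf 1$ replaced by any preference vector $v$ with positive entries. -/

import Mathlib

open Filter Topology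
open scoped ENNReal Matrix

namespace FCentrality

noncomputable section

/-! ### Digraphs -/

/-- Between every ordered pair of nodes there is a directed path
(the trivial path joins a node to itself). -/
def StronglyConnected {V : Type*} (G : Digraph V) : Prop :=
  ∀ i j : V, Relation.ReflTransGen G.Adj i j

open Classical in
/-- The `0`-`1` adjacency matrix: the entry `(i, j)` is `1` exactly when there is an edge from
`i` to `j`. -/
def adjMatrix {V : Type*} (G : Digraph V) : Matrix V V ℝ :=
  Matrix.of fun i j => if G.Adj i j then 1 else 0

/-- The number of edges starting at `i`. -/
def outDegree {V : Type*} (G : Digraph V) (i : V) : ℕ := {j : V | G.Adj i j}.ncard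

/-- The number of edges ending at `i`. -/
def inDegree {V : Type*} (G : Digraph V) (i : V) : ℕ := {j : V | G.Adj j i}.ncard

/-! ### The classes of admissible functions -/

/-- A member `f(z) = ∑ c_k z ^ k` of the class `𝒫`: all Maclaurin coefficients are real and strictly
positive, and the radius of convergence is positive. On its disk of convergence the function is
determined by its coefficients, and only its values there are used. -/
structure ClassP where
  /-- The Maclaurin coefficients. -/
  coeff : ℕ → ℝ
  coeff_pos : ∀ k, 0 < coeff k
  radius_pos : 0 < (FormalMultilinearSeries.ofScalars ℝ coeff).radius

/-- The radius of convergence `R_f`, possibly `∞`. -/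
def ClassP.radius (f : ClassP) : ℝ≥0∞ :=
  (FormalMultilinearSeries.ofScalars ℝ f.coeff).radius

/-- The subclass of entire functions. -/
def ClassP.IsEntire (f : ClassP) : Prop := f.radius = ∞

/-- The subclass of functions with finite radius of convergence whose (positive-term) Maclaurin
series diverges at the positive boundary point `R_f`. -/
def ClassP.DivergesAtBoundary (f : ClassP) : Prop :=
  f.radius ≠ ∞ ∧ ¬ Summable fun k => f.coeff k * f.radius.toReal ^ k

/-! ### Spectral notions for real matrices -/

variable {V : Type*} [Fintype V] [DecidableEq V]

/-- The spectral radius, i.e. the largest modulus of a complex eigenvalue. -/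
def specRadius (A : Matrix V V ℝ) : ℝ≥0∞ :=
  spectralRadius ℂ (A.map (algebraMap ℝ ℂ))

/-- A nonnegative matrix is primitive if its complex eigenvalues, listed with algebraic
multiplicity, are `r, μ₂, …, μₙ` with `r` real and `r > |μₖ|` for `k = 2, …, n`. -/
def PrimitiveMatrix (A : Matrix V V ℝ) : Prop :=
  (∀ i j, 0 ≤ A i j) ∧
    ∃ (r : ℝ) (s : Multiset ℂ),
      (A.map (algebraMap ℝ ℂ)).charpoly.roots = (r : ℂ) ::ₘ s ∧ ∀ μ ∈ s, ‖μ‖ < r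

/-- `x` is a positive right eigenvector for the spectral radius of `A`. -/
def IsDominantRight (A : Matrix V V ℝ) (x : V → ℝ) : Prop :=
  (∀ i, 0 < x i) ∧ A *ᵥ x = (specRadius A).toReal • x

/-- `y` is a positive left eigenvector for the spectral radius of `A`. -/
def IsDominantLeft (A : Matrix V V ℝ) (y : V → ℝ) : Prop :=
  (∀ i, 0 < y i) ∧ y ᵥ* A = (specRadius A).toReal • y

/-! ### Functional centralities -/

/-- The terms `c_k M ^ k` of the power series defining `f(M)`. -/
def ClassP.matrixTerm (f : ClassP) (M : Matrix V V ℝ) (k : ℕ) : Matrix V V ℝ :=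
  f.coeff k • M ^ k

/-- The matrix function `f(M) = ∑ c_k M ^ k`. -/
def ClassP.matrixFun (f : ClassP) (M : Matrix V V ℝ) : Matrix V V ℝ :=
  ∑' k, f.matrixTerm M k

/-- The upper end `t* = R_f / ρ(A)` of the range of parameters (`∞` if `R_f = ∞` or `ρ(A) = 0`). -/
def tStar (f : ClassP) (A : Matrix V V ℝ) : ℝ≥0∞ := f.radius / specRadius A

/-- The filter describing `t → T-` for real `t`; for `T = ∞` it is `t → ∞`. -/
def toLeft (T : ℝ≥0∞) : Filter ℝ := if T = ∞ then atTop else 𝓝[<] T.toReal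

/-- Broadcast total `f`-communicability `f(tA) v`, with preference vector `v`. -/
def broadcast (f : ClassP) (A : Matrix V V ℝ) (v : V → ℝ) (t : ℝ) : V → ℝ :=
  f.matrixFun (t • A) *ᵥ v

/-- Receive total `f`-communicability `f(tAᵀ) v`, with preference vector `v`. -/
def receive (f : ClassP) (A : Matrix V V ℝ) (v : V → ℝ) (t : ℝ) : V → ℝ :=
  f.matrixFun (t • Aᵀ) *ᵥ v

/-! ### Convergence of rankings -/

/-- Whenever `w` ranks `j` strictly above `i`, so do the scores `s t` for all `t` near the
limit. -/
def OrderConverges {V : Type*} (l : Filter ℝ) (s : ℝ → V → ℝ) (w : V → ℝ) : Prop :=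
  ∀ i j, w i < w j → ∀ᶠ t in l, s t i < s t j

/-- The scores converge to a target score vector after a rescaling by a positive factor and a
shift, both common to all nodes (so that the ranking is unaffected), and the order of the nodes
converges to the order given by the target. -/
def RankingsConvergeAffine {V : Type*} (l : Filter ℝ) (s : ℝ → V → ℝ) (w : V → ℝ) : Prop :=
  OrderConverges l s w ∧
    ∃ a b : ℝ → ℝ, (∀ t, 0 < a t) ∧ Tendsto (fun t i => a t * s t i + b t) l (𝓝 w)

/-- The same with a rescaling alone and no shift. -/
def RankingsConverge {V : Type*} (l : Filter ℝ) (s : ℝ → V → ℝ) (w : V → ℝ) : Prop :=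
  OrderConverges l s w ∧
    ∃ a : ℝ → ℝ, (∀ t, 0 < a t) ∧ Tendsto (fun t i => a t * s t i) l (𝓝 w)

end

end FCentrality

/-!
The limit at the right end of the parameter range rests on two facts. The first is spectral: for a
nonnegative matrix `M` with positive right and left eigenvectors `x`, `y` for `ρ > 0`, such that
every complex eigenvector for an eigenvalue of modulus `ρ` is a multiple of `x`, the vectors
`M ^ k v / ρ ^ k` tend to `(y ⬝ v / y ⬝ x) x` (`tendsto_pow_mulVec_div`). This follows from Gelfand's
formula applied to `M - ρ x yᵀ / (y ⬝ x)`. The second is a summation argument: `f(t M) v / f(t ρ)`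
is the average of these vectors with weights `c_k (t ρ) ^ k / f(t ρ)`. When `f` is entire or its
series diverges at `R_f`, each single weight tends to zero as `t ρ → R_f`
(`ClassP.tendsto_term_div_tsum`), so that the averages have the same limit as the vectors
(`rankingsConverge_of_tendsto_pow`). No shift is needed.

The spectral hypotheses come from Perron–Frobenius theory, proved here for the adjacency matrix of
a strongly connected digraph. A positive eigenvector exists by a Collatz–Wielandt maximisation
(`NonnegIrreducible.exists_pos_eigenvector`), its eigenvalue is the spectral radius
(`specRadius_eq_of_pos_eigenvector`), and it is unique up to scaling
(`NonnegIrreducible.eigenvector_unique`). If `A` is primitive, `ρ` is the only eigenvalue of modulus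
`ρ`; for `(1 - ε) A + ε I` the same holds by the equality case of the triangle inequality. The
remaining case `ρ = 0` is that of a single node without a loop, where there is nothing to rank.

Near `t = 0`, after subtracting `c₀` and dividing by `c₁ t`, the scores tend to the row sums of the
matrix, by dominated convergence (`rankingsConvergeAffine_rowSums`). Statements on receive
centralities are those on broadcast centralities of the transpose.
-/

namespace FCentrality

/-! ### Nonnegative matrices with a positive eigenvector -/

section Matrices

variable {V : Type*} [Fintype V]

theorem mem_spectrum_iff_exists_mulVec [DecidableEq V] {B : Matrix V V ℂ} {μ : ℂ} :
    μ ∈ spectrum ℂ B ↔ ∃ z : V → ℂ, z ≠ 0 ∧ B *ᵥ z = μ • z := by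
  rw [Matrix.mem_spectrum_iff_isRoot_charpoly, Polynomial.IsRoot, Matrix.eval_charpoly,
    ← Matrix.exists_mulVec_eq_zero_iff]
  refine exists_congr fun z => and_congr_right fun _ => ?_
  rw [Matrix.sub_mulVec, sub_eq_zero, eq_comm, Matrix.scalar_apply, ← Matrix.smul_one_eq_diagonal,
    Matrix.smul_mulVec, Matrix.one_mulVec]

theorem specRadius_transpose [DecidableEq V] (A : Matrix V V ℝ) : specRadius Aᵀ = specRadius A := by
  have h : spectrum ℂ (A.map (algebraMap ℝ ℂ))ᵀ = spectrum ℂ (A.map (algebraMap ℝ ℂ)) := by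
    ext μ
    rw [Matrix.mem_spectrum_iff_isRoot_charpoly, Matrix.mem_spectrum_iff_isRoot_charpoly,
      Matrix.charpoly_transpose]
  rw [specRadius, specRadius, Matrix.transpose_map, spectralRadius, spectralRadius, h]

/-- Comparison at an index maximising `‖z i‖ / x i`. -/
theorem norm_eigenvalue_le {M : Matrix V V ℝ} (hM : ∀ i j, 0 ≤ M i j) {ρ : ℝ} {x : V → ℝ}
    (hx : ∀ i, 0 < x i) (hMx : M *ᵥ x = ρ • x) {μ : ℂ} {z : V → ℂ} (hz : z ≠ 0)
    (hMz : M.map (algebraMap ℝ ℂ) *ᵥ z = μ • z) : ‖μ‖ ≤ ρ := by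
  obtain ⟨k, hk⟩ := Function.ne_iff.mp hz
  have : Nonempty V := ⟨k⟩
  obtain ⟨i, hi⟩ := Finite.exists_max fun i => ‖z i‖ / x i
  have hle : ∀ j, ‖z j‖ ≤ ‖z i‖ / x i * x j := fun j => (div_le_iff₀ (hx j)).mp (hi j)
  have hzi : 0 < ‖z i‖ := by
    have h1 : 0 < ‖z k‖ / x k := div_pos (norm_pos_iff.mpr hk) (hx k)
    by_contra h
    have h0 : ‖z i‖ = 0 := le_antisymm (not_lt.mp h) (norm_nonneg _)
    have := hi k
    simp only [h0, zero_div] at this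
    linarith
  have h1 : μ * z i = ∑ j, (M i j : ℂ) * z j := by
    have := congrFun hMz i
    simpa [Matrix.mulVec, dotProduct] using this.symm
  have h2 : ∑ j, M i j * x j = ρ * x i := by
    simpa [Matrix.mulVec, dotProduct] using congrFun hMx i
  have h3 : ‖μ‖ * ‖z i‖ ≤ ρ * ‖z i‖ := by
    calc ‖μ‖ * ‖z i‖ = ‖∑ j, (M i j : ℂ) * z j‖ := by rw [← h1, norm_mul]
      _ ≤ ∑ j, ‖(M i j : ℂ) * z j‖ := norm_sum_le _ _
      _ ≤ ∑ j, ‖z i‖ / x i * (M i j * x j) := by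
        refine Finset.sum_le_sum fun j _ => ?_
        rw [norm_mul, Complex.norm_real, Real.norm_of_nonneg (hM i j)]
        calc M i j * ‖z j‖ ≤ M i j * (‖z i‖ / x i * x j) :=
              mul_le_mul_of_nonneg_left (hle j) (hM i j)
          _ = _ := by ring
      _ = ρ * ‖z i‖ := by
        rw [← Finset.mul_sum, h2]
        field_simp [(hx i).ne']
  exact le_of_mul_le_mul_right h3 hzi

theorem eigenvalue_nonneg [Nonempty V] {M : Matrix V V ℝ} (hM : ∀ i j, 0 ≤ M i j) {ρ : ℝ}
    {x : V → ℝ} (hx : ∀ i, 0 < x i) (hMx : M *ᵥ x = ρ • x) : 0 ≤ ρ := by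
  obtain ⟨i⟩ := ‹Nonempty V›
  have h2 : ∑ j, M i j * x j = ρ * x i := by
    simpa [Matrix.mulVec, dotProduct] using congrFun hMx i
  have h3 : 0 ≤ ρ * x i := h2 ▸ Finset.sum_nonneg fun j _ => mul_nonneg (hM i j) (hx j).le
  exact nonneg_of_mul_nonneg_left h3 (hx i)

theorem map_mulVec_ofReal (M : Matrix V V ℝ) (x : V → ℝ) :
    M.map (algebraMap ℝ ℂ) *ᵥ (fun i => (x i : ℂ)) = fun i => ((M *ᵥ x) i : ℂ) := by
  ext i
  simp [Matrix.mulVec, dotProduct]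

theorem specRadius_eq_of_pos_eigenvector [DecidableEq V] [Nonempty V] {M : Matrix V V ℝ}
    (hM : ∀ i j, 0 ≤ M i j) {ρ : ℝ} {x : V → ℝ} (hx : ∀ i, 0 < x i) (hMx : M *ᵥ x = ρ • x) :
    specRadius M = ENNReal.ofReal ρ := by
  have hρ := eigenvalue_nonneg hM hx hMx
  apply le_antisymm
  · refine iSup₂_le fun μ hμ => ?_
    obtain ⟨z, hz, hMz⟩ := mem_spectrum_iff_exists_mulVec.mp hμ
    rw [← enorm_eq_nnnorm, ← ofReal_norm]
    exact ENNReal.ofReal_le_ofReal (norm_eigenvalue_le hM hx hMx hz hMz)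
  · have hmem : (ρ : ℂ) ∈ spectrum ℂ (M.map (algebraMap ℝ ℂ)) := by
      refine mem_spectrum_iff_exists_mulVec.mpr ⟨fun i => (x i : ℂ), ?_, ?_⟩
      · obtain ⟨i⟩ := ‹Nonempty V›
        exact Function.ne_iff.mpr ⟨i, by simpa using (hx i).ne'⟩
      · rw [map_mulVec_ofReal, hMx]
        ext i
        simp
    refine le_trans (le_of_eq ?_) (le_iSup₂ (f := fun k _ => (‖k‖₊ : ℝ≥0∞)) _ hmem)
    rw [← enorm_eq_nnnorm, ← ofReal_norm, Complex.norm_real, Real.norm_of_nonneg hρ]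

theorem pow_mulVec_eigenvector [DecidableEq V] {M : Matrix V V ℝ} {ρ : ℝ} {x : V → ℝ}
    (hMx : M *ᵥ x = ρ • x) (k : ℕ) : M ^ k *ᵥ x = ρ ^ k • x := by
  induction k with
  | zero => simp
  | succ k ih =>
    rw [pow_succ, ← Matrix.mulVec_mulVec, hMx, Matrix.mulVec_smul, ih, smul_smul, pow_succ,
      mul_comm]

theorem pow_entry_nonneg [DecidableEq V] {M : Matrix V V ℝ} (hM : ∀ i j, 0 ≤ M i j) (k : ℕ) :
    ∀ i j, 0 ≤ (M ^ k) i j := by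
  induction k with
  | zero =>
    intro i j
    rw [pow_zero, Matrix.one_apply]
    split_ifs <;> norm_num
  | succ k ih =>
    intro i j
    rw [pow_succ, Matrix.mul_apply]
    exact Finset.sum_nonneg fun l _ => mul_nonneg (ih i l) (hM l j)

theorem pow_entry_le [DecidableEq V] {M : Matrix V V ℝ} (hM : ∀ i j, 0 ≤ M i j) {ρ : ℝ} {x : V → ℝ}
    (hx : ∀ i, 0 < x i) (hMx : M *ᵥ x = ρ • x) (k : ℕ) (i j : V) :
    (M ^ k) i j ≤ x i / x j * ρ ^ k := by
  have h2 : ∑ l, (M ^ k) i l * x l = ρ ^ k * x i := by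
    simpa [Matrix.mulVec, dotProduct] using congrFun (pow_mulVec_eigenvector hMx k) i
  have h3 : (M ^ k) i j * x j ≤ ρ ^ k * x i := by
    rw [← h2]
    exact Finset.single_le_sum
      (fun l _ => mul_nonneg (pow_entry_nonneg hM k i l) (hx l).le) (Finset.mem_univ j)
  calc (M ^ k) i j ≤ ρ ^ k * x i / x j := (le_div_iff₀ (hx j)).mpr h3
    _ = _ := by ring

/-! ### Perron–Frobenius theory of irreducible matrices -/

/-- An entrywise nonnegative matrix whose associated digraph, with an edge from `i` to `j` when
the entry `(i, j)` is positive, is strongly connected. The zero matrix of size one qualifies. -/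
structure NonnegIrreducible (A : Matrix V V ℝ) : Prop where
  nonneg : ∀ i j, 0 ≤ A i j
  connected : ∀ i j, Relation.ReflTransGen (fun i j => 0 < A i j) i j

theorem NonnegIrreducible.transpose {V : Type*} {A : Matrix V V ℝ} (hA : NonnegIrreducible A) :
    NonnegIrreducible Aᵀ :=
  ⟨fun i j => hA.nonneg j i, fun i j => Relation.reflTransGen_swap.mp (hA.connected j i)⟩

theorem NonnegIrreducible.exists_pow_pos [DecidableEq V] {A : Matrix V V ℝ}
    (hA : NonnegIrreducible A) (i j : V) :
    ∃ k : ℕ, 0 < (A ^ k) i j := by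
  induction hA.connected i j with
  | refl => exact ⟨0, by simp⟩
  | @tail l m _ hlm ih =>
    obtain ⟨k, hk⟩ := ih
    refine ⟨k + 1, ?_⟩
    rw [pow_succ, Matrix.mul_apply]
    exact (mul_pos hk hlm).trans_le (Finset.single_le_sum (f := fun l => (A ^ k) i l * A l m)
      (fun l _ => mul_nonneg (pow_entry_nonneg hA.nonneg k i l) (hA.nonneg l m))
      (Finset.mem_univ l))

/-- A sum of powers of `A`. Multiplying by it makes strict any nonzero inequality `0 ≤ u`, while
commuting with `A`. -/
theorem NonnegIrreducible.exists_commute_pos [DecidableEq V] {A : Matrix V V ℝ}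
    (hA : NonnegIrreducible A) :
    ∃ B : Matrix V V ℝ, Commute A B ∧ ∀ i j, 0 < B i j := by
  choose k hk using hA.exists_pow_pos
  refine ⟨∑ i, ∑ j, A ^ k i j,
    Commute.sum_right _ _ _ fun i _ => Commute.sum_right _ _ _ fun j _ =>
      (Commute.refl A).pow_right _, fun i j => ?_⟩
  simp only [Matrix.sum_apply]
  have h : ∀ a b, 0 ≤ (A ^ k a b) i j := fun a b => pow_entry_nonneg hA.nonneg _ i j
  calc 0 < (A ^ k i j) i j := hk i j
    _ ≤ ∑ b, (A ^ k i b) i j :=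
      Finset.single_le_sum (f := fun b => (A ^ k i b) i j) (fun b _ => h i b) (Finset.mem_univ j)
    _ ≤ _ := Finset.single_le_sum (f := fun a => ∑ b, (A ^ k a b) i j)
      (fun a _ => Finset.sum_nonneg fun b _ => h a b) (Finset.mem_univ i)

theorem mulVec_pos_of_pos {B : Matrix V V ℝ} (hB : ∀ i j, 0 < B i j) {u : V → ℝ}
    (hu : ∀ i, 0 ≤ u i) (hu0 : u ≠ 0) (i : V) : 0 < (B *ᵥ u) i := by
  obtain ⟨k, hk⟩ := Function.ne_iff.mp hu0
  exact Finset.sum_pos' (fun j _ => mul_nonneg (hB i j).le (hu j))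
    ⟨k, Finset.mem_univ k, mul_pos (hB i k) (lt_of_le_of_ne (hu k) (Ne.symm hk))⟩

/-- Existence of a positive eigenvector, by the Collatz–Wielandt argument: maximise `r` over all
`x` in the simplex with `r x ≤ A x`. At a maximum, `A x - r x` vanishes, since otherwise a
positive matrix commuting with `A` turns `x` into a vector allowing a larger `r`. -/
theorem NonnegIrreducible.exists_pos_eigenvector [Nonempty V] {A : Matrix V V ℝ}
    (hA : NonnegIrreducible A) : ∃ (ρ : ℝ) (x : V → ℝ), (∀ i, 0 < x i) ∧ A *ᵥ x = ρ • x := by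
  classical
  obtain ⟨B, hAB, hB⟩ := hA.exists_commute_pos
  set C : ℝ := ∑ i, ∑ j, A i j
  have hC : 0 ≤ C := Finset.sum_nonneg fun i _ => Finset.sum_nonneg fun j _ => hA.nonneg i j
  -- Summing `r x ≤ A x` over the coordinates of a probability vector `x` gives `r ≤ C`.
  have hbound : ∀ (r : ℝ) (x : V → ℝ), x ∈ stdSimplex ℝ V → (∀ i, r * x i ≤ (A *ᵥ x) i) →
      r ≤ C := by
    intro r x hx hr
    have hx1 : ∀ j, x j ≤ 1 := fun j => by
      rw [← hx.2]
      exact Finset.single_le_sum (fun l _ => hx.1 l) (Finset.mem_univ j)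
    calc r = ∑ i, r * x i := by rw [← Finset.mul_sum, hx.2, mul_one]
      _ ≤ ∑ i, ∑ j, A i j * x j := Finset.sum_le_sum fun i _ => hr i
      _ ≤ C := Finset.sum_le_sum fun i _ => Finset.sum_le_sum fun j _ =>
        mul_le_of_le_one_right (hA.nonneg i j) (hx1 j)
  set S : Set (ℝ × (V → ℝ)) :=
    (Set.Icc 0 C ×ˢ stdSimplex ℝ V) ∩ {p | ∀ i, p.1 * p.2 i ≤ (A *ᵥ p.2) i}
  have hS : IsCompact S := by
    refine (isCompact_Icc.prod (isCompact_stdSimplex ℝ V)).inter_right ?_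
    simp only [Set.ofPred_forall]
    refine isClosed_iInter fun i => isClosed_le (by fun_prop) ?_
    exact (continuous_apply i).comp (Continuous.matrix_mulVec continuous_const continuous_snd)
  have hSne : S.Nonempty := by
    obtain ⟨i⟩ := ‹Nonempty V›
    refine ⟨(0, Pi.single i 1), ⟨⟨le_rfl, hC⟩, single_mem_stdSimplex ℝ i⟩, fun j => ?_⟩
    simpa using hA.nonneg j i
  obtain ⟨⟨r, x⟩, ⟨⟨⟨hr0, -⟩, hx⟩, hrx⟩, hmax⟩ := hS.exists_isMaxOn hSne continuousOn_fst
  simp only at hr0 hx hrx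
  have hx0 : x ≠ 0 := by
    rintro rfl
    simpa using hx.2
  set y := B *ᵥ x
  have hy : ∀ i, 0 < y i := mulVec_pos_of_pos hB hx.1 hx0
  have hcomm : A *ᵥ y - r • y = B *ᵥ (A *ᵥ x - r • x) := by
    rw [Matrix.mulVec_sub, Matrix.mulVec_smul, Matrix.mulVec_mulVec, Matrix.mulVec_mulVec,
      hAB.eq]
  have hzero : A *ᵥ x - r • x = 0 := by
    by_contra hne
    have hpos : ∀ i, 0 < (A *ᵥ y - r • y) i := by
      rw [hcomm]
      refine mulVec_pos_of_pos hB (fun i => ?_) hne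
      simpa using hrx i
    obtain ⟨i, hi⟩ := Finite.exists_min fun i => (A *ᵥ y) i / y i
    have hri : r < (A *ᵥ y) i / y i := by
      rw [lt_div_iff₀ (hy i)]
      simpa using hpos i
    have hs : 0 < ∑ j, y j := Finset.sum_pos (fun j _ => hy j) ⟨i, Finset.mem_univ i⟩
    have hsimp : (∑ j, y j)⁻¹ • y ∈ stdSimplex ℝ V := by
      refine ⟨fun j => mul_nonneg (inv_nonneg.mpr hs.le) (hy j).le, ?_⟩
      simp only [Pi.smul_apply, smul_eq_mul, ← Finset.mul_sum]
      exact inv_mul_cancel₀ hs.ne'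
    have hle : ∀ j, (A *ᵥ y) i / y i * ((∑ j, y j)⁻¹ • y) j ≤ (A *ᵥ ((∑ j, y j)⁻¹ • y)) j := by
      intro j
      have h := (le_div_iff₀ (hy j)).mp (hi j)
      rw [Matrix.mulVec_smul, Pi.smul_apply, Pi.smul_apply, smul_eq_mul, smul_eq_mul,
        mul_left_comm]
      exact mul_le_mul_of_nonneg_left h (inv_nonneg.mpr hs.le)
    have := hmax (show ((A *ᵥ y) i / y i, (∑ j, y j)⁻¹ • y) ∈ S from
      ⟨⟨⟨hr0.trans hri.le, hbound _ _ hsimp hle⟩, hsimp⟩, hle⟩)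
    exact absurd hri (not_lt.mpr this)
  refine ⟨r, y, hy, ?_⟩
  rw [hzero, Matrix.mulVec_zero] at hcomm
  exact sub_eq_zero.mp hcomm

/-- Geometric simplicity: subtract from `z` the largest multiple of `x` that leaves a nonnegative
vector; the difference has a zero coordinate, and zeros spread along the edges. -/
theorem NonnegIrreducible.eigenvector_unique [Nonempty V] {A : Matrix V V ℝ}
    (hA : NonnegIrreducible A) {ρ : ℝ} {x : V → ℝ} (hx : ∀ i, 0 < x i) (hAx : A *ᵥ x = ρ • x)
    {z : V → ℝ} (hAz : A *ᵥ z = ρ • z) : ∃ c : ℝ, z = c • x := by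
  obtain ⟨i, hi⟩ := Finite.exists_min fun i => z i / x i
  set c := z i / x i
  set u := z - c • x
  have hu : ∀ j, 0 ≤ u j := fun j => by
    have := (le_div_iff₀ (hx j)).mp (hi j)
    simpa [u] using this
  have hAu : A *ᵥ u = ρ • u := by
    rw [Matrix.mulVec_sub, Matrix.mulVec_smul, hAx, hAz, smul_sub, smul_comm]
  have hui : u i = 0 := by
    simp [u, c, (hx i).ne']
  refine ⟨c, sub_eq_zero.mp (funext fun j => ?_)⟩
  change u j = 0
  induction hA.connected i j with
  | refl => exact hui
  | @tail l m _ hlm ih =>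
    have h : ∑ k, A l k * u k = 0 := by
      have := congrFun hAu l
      simpa [Matrix.mulVec, dotProduct, ih] using this
    have := (Finset.sum_eq_zero_iff_of_nonneg
      fun k _ => mul_nonneg (hA.nonneg l k) (hu k)).mp h m (Finset.mem_univ m)
    exact (mul_eq_zero.mp this).resolve_left hlm.ne'

theorem NonnegIrreducible.eigenvector_unique_complex [Nonempty V] {A : Matrix V V ℝ}
    (hA : NonnegIrreducible A) {ρ : ℝ} {x : V → ℝ} (hx : ∀ i, 0 < x i) (hAx : A *ᵥ x = ρ • x)
    {z : V → ℂ} (hAz : A.map (algebraMap ℝ ℂ) *ᵥ z = (ρ : ℂ) • z) :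
    ∃ c : ℂ, z = fun i => c * (x i : ℂ) := by
  have hre : A *ᵥ (fun i => (z i).re) = ρ • fun i => (z i).re := by
    ext i
    simpa [Matrix.mulVec, dotProduct] using congrArg Complex.re (congrFun hAz i)
  have him : A *ᵥ (fun i => (z i).im) = ρ • fun i => (z i).im := by
    ext i
    simpa [Matrix.mulVec, dotProduct] using congrArg Complex.im (congrFun hAz i)
  obtain ⟨a, ha⟩ := hA.eigenvector_unique hx hAx hre
  obtain ⟨b, hb⟩ := hA.eigenvector_unique hx hAx him
  refine ⟨⟨a, b⟩, funext fun i => Complex.ext ?_ ?_⟩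
  · simpa using congrFun ha i
  · simpa using congrFun hb i

/-! ### Convergence of the normalised powers -/

open scoped Matrix.Norms.Operator in
/-- By Gelfand's formula. -/
theorem tendsto_pow_div_mulVec_zero [DecidableEq V] [Nonempty V] {B : Matrix V V ℂ} {ρ : ℝ}
    (hρ : 0 < ρ) (hB : ∀ μ ∈ spectrum ℂ B, ‖μ‖ < ρ) (w : V → ℂ) :
    Tendsto (fun k : ℕ => ‖B ^ k *ᵥ w‖ / ρ ^ k) atTop (𝓝 0) := by
  lift ρ to NNReal using hρ.le
  have hlt : spectralRadius ℂ B < ρ :=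
    spectrum.spectralRadius_lt_of_forall_lt B fun μ hμ => NNReal.coe_lt_coe.mp (hB μ hμ)
  obtain ⟨q, hq1, hq2⟩ := ENNReal.lt_iff_exists_nnreal_btwn.mp hlt
  have hqρ : (q : ℝ) < ρ := by exact_mod_cast hq2
  have hev : ∀ᶠ k : ℕ in atTop, ‖B ^ k‖ ≤ (q : ℝ) ^ k := by
    filter_upwards [(spectrum.pow_nnnorm_pow_one_div_tendsto_nhds_spectralRadius B).eventually
      (gt_mem_nhds hq1), eventually_gt_atTop 0] with k hk hk0
    have hk' : (0 : ℝ) < k := by exact_mod_cast hk0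
    have h1 : (‖B ^ k‖₊ : ℝ≥0∞) < (q : ℝ≥0∞) ^ (k : ℝ) := by
      rw [one_div] at hk
      exact (ENNReal.rpow_inv_lt_iff hk').mp hk
    rw [ENNReal.rpow_natCast] at h1
    have h2 : ‖B ^ k‖₊ < q ^ k := by exact_mod_cast h1
    exact_mod_cast h2.le
  have hgeo : Tendsto (fun k : ℕ => ((q : ℝ) / ρ) ^ k * ‖w‖) atTop (𝓝 0) := by
    simpa using (tendsto_pow_atTop_nhds_zero_of_lt_one (div_nonneg q.2 hρ.le)
      ((div_lt_one hρ).mpr hqρ)).mul_const ‖w‖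
  refine squeeze_zero' (Eventually.of_forall fun k => by positivity) ?_ hgeo
  filter_upwards [hev] with k hk
  rw [div_pow, div_mul_eq_mul_div]
  gcongr
  exact (Matrix.linfty_opNorm_mulVec _ _).trans (by gcongr)

/-- The powers of a nonnegative matrix that has positive right and left eigenvectors `x` and `y`
for `ρ`, where `x` is, up to scaling, the only eigenvector for an eigenvalue of modulus `ρ`.
Subtracting the rank-one matrix `ρ x yᵀ / (y ⬝ x)` leaves a matrix whose eigenvalues have modulus
less than `ρ`. -/
theorem tendsto_pow_mulVec_div [DecidableEq V] [Nonempty V] {M : Matrix V V ℝ}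
    (hM : ∀ i j, 0 ≤ M i j) {ρ : ℝ} (hρ : 0 < ρ) {x y : V → ℝ} (hx : ∀ i, 0 < x i)
    (hy : ∀ i, 0 < y i) (hMx : M *ᵥ x = ρ • x) (hMy : y ᵥ* M = ρ • y)
    (hsimple : ∀ (μ : ℂ) (z : V → ℂ), ‖μ‖ = ρ → M.map (algebraMap ℝ ℂ) *ᵥ z = μ • z →
      ∃ c : ℂ, z = fun i => c * (x i : ℂ)) (v : V → ℝ) (i : V) :
    Tendsto (fun k : ℕ => (M ^ k *ᵥ v) i / ρ ^ k) atTop (𝓝 (y ⬝ᵥ v / (y ⬝ᵥ x) * x i)) := by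
  have hyx : 0 < y ⬝ᵥ x :=
    Finset.sum_pos (fun j _ => mul_pos (hy j) (hx j)) ⟨i, Finset.mem_univ i⟩
  set κ := y ⬝ᵥ v / (y ⬝ᵥ x)
  set w := v - κ • x
  have hyw : y ⬝ᵥ w = 0 := by
    simp [w, κ, dotProduct_sub, dotProduct_smul, hyx.ne']
  set N := M.map (algebraMap ℝ ℂ) with hN
  set xc : V → ℂ := fun j => (x j : ℂ)
  set yc : V → ℂ := fun j => (y j : ℂ)
  have hyN : yc ᵥ* N = (ρ : ℂ) • yc := by
    ext j
    have := congrArg (fun r : ℝ => (r : ℂ)) (congrFun hMy j)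
    simpa [Matrix.vecMul, dotProduct, hN, yc] using this
  have hyxc : yc ⬝ᵥ xc = ((y ⬝ᵥ x : ℝ) : ℂ) := by simp [dotProduct, xc, yc]
  have hyxc0 : yc ⬝ᵥ xc ≠ 0 := by
    rw [hyxc]
    exact_mod_cast hyx.ne'
  set B : Matrix V V ℂ := N - ((ρ : ℂ) / (yc ⬝ᵥ xc)) • Matrix.vecMulVec xc yc
  have hBmul : ∀ z, B *ᵥ z = N *ᵥ z - ((ρ : ℂ) / (yc ⬝ᵥ xc) * (yc ⬝ᵥ z)) • xc := by
    intro z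
    rw [Matrix.sub_mulVec, Matrix.smul_mulVec, Matrix.vecMulVec_mulVec]
    ext j
    simp only [Pi.sub_apply, Pi.smul_apply, MulOpposite.smul_eq_mul_unop, MulOpposite.unop_op,
      smul_eq_mul]
    ring
  have hyNz : ∀ z, yc ⬝ᵥ (N *ᵥ z) = ρ * (yc ⬝ᵥ z) := fun z => by
    rw [Matrix.dotProduct_mulVec, hyN, smul_dotProduct, smul_eq_mul]
  have hBspec : ∀ μ ∈ spectrum ℂ B, ‖μ‖ < ρ := by
    intro μ hμ
    obtain ⟨z, hz, hBz⟩ := mem_spectrum_iff_exists_mulVec.mp hμ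
    by_cases hμ0 : μ = 0
    · simpa [hμ0] using hρ
    -- `y` annihilates the range of `B`.
    have hyz : yc ⬝ᵥ z = 0 := by
      have h := congrArg (fun t => yc ⬝ᵥ t) (hBmul z)
      simp only [hBz, dotProduct_sub, hyNz, dotProduct_smul, smul_eq_mul] at h
      have h' : μ * (yc ⬝ᵥ z) = 0 := by
        rw [h]
        field_simp
        ring
      exact (mul_eq_zero.mp h').resolve_left hμ0
    have hNz : N *ᵥ z = μ • z := by
      rw [← hBz, hBmul, hyz]
      simp
    refine lt_of_le_of_ne (norm_eigenvalue_le hM hx hMx hz hNz) fun heq => ?_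
    obtain ⟨c, hc⟩ := hsimple μ z heq hNz
    have hzc : z = c • xc := hc
    rw [hzc, dotProduct_smul, smul_eq_mul] at hyz
    have hc0 : c = 0 := (mul_eq_zero.mp hyz).resolve_right hyxc0
    exact hz (by rw [hzc, hc0, zero_smul])
  set wc : V → ℂ := fun j => (w j : ℂ)
  have hywc : yc ⬝ᵥ wc = 0 := by
    have := congrArg (fun r : ℝ => (r : ℂ)) hyw
    simpa [dotProduct, yc, wc] using this
  have hpow : ∀ k : ℕ, B ^ k *ᵥ wc = (fun j => ((M ^ k *ᵥ w) j : ℂ)) ∧ yc ⬝ᵥ (B ^ k *ᵥ wc) = 0 := by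
    intro k
    induction k with
    | zero => simpa [wc] using hywc
    | succ k ih =>
      have h1 : B ^ (k + 1) *ᵥ wc = N *ᵥ (B ^ k *ᵥ wc) := by
        rw [pow_succ', ← Matrix.mulVec_mulVec, hBmul, ih.2]
        simp
      refine ⟨?_, ?_⟩
      · rw [h1, ih.1, map_mulVec_ofReal, pow_succ', Matrix.mulVec_mulVec]
      · rw [h1, hyNz, ih.2, mul_zero]
  have hlim : Tendsto (fun k : ℕ => (M ^ k *ᵥ w) i / ρ ^ k) atTop (𝓝 0) := by
    refine squeeze_zero_norm (fun k => ?_) (tendsto_pow_div_mulVec_zero hρ hBspec wc)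
    rw [norm_div, norm_pow, Real.norm_of_nonneg hρ.le]
    gcongr
    have h := norm_le_pi_norm (B ^ k *ᵥ wc) i
    rw [(hpow k).1] at h ⊢
    simpa using h
  have hv : v = κ • x + w := by simp [w]
  have heq : (fun k : ℕ => (M ^ k *ᵥ v) i / ρ ^ k) =
      fun k : ℕ => κ * x i + (M ^ k *ᵥ w) i / ρ ^ k := by
    ext k
    have hk : ρ ^ k ≠ 0 := (pow_pos hρ k).ne'
    rw [hv, Matrix.mulVec_add, Matrix.mulVec_smul, pow_mulVec_eigenvector hMx]
    simp only [Pi.add_apply, Pi.smul_apply, smul_eq_mul]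
    field_simp
  rw [heq]
  simpa using hlim.const_add (κ * x i)

end Matrices

/-! ### Convergence of scores and of rankings -/

section Rankings

variable {V : Type*} {l : Filter ℝ} {s : ℝ → V → ℝ} {w : V → ℝ}

theorem OrderConverges.of_tendsto [Finite V] {a b : ℝ → ℝ} (ha : ∀ t, 0 < a t)
    (h : Tendsto (fun t i => a t * s t i + b t) l (𝓝 w)) : OrderConverges l s w := by
  intro i j hij
  rw [tendsto_pi_nhds] at h
  filter_upwards [(h i).eventually_lt (h j) hij] with t ht
  exact lt_of_mul_lt_mul_left (lt_of_add_lt_add_right ht) (ha t).le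

theorem RankingsConvergeAffine.of_tendsto [Finite V] {a b : ℝ → ℝ} (ha : ∀ t, 0 < a t)
    (h : Tendsto (fun t i => a t * s t i + b t) l (𝓝 w)) : RankingsConvergeAffine l s w :=
  ⟨.of_tendsto ha h, a, b, ha, h⟩

theorem RankingsConverge.of_tendsto [Finite V] {a : ℝ → ℝ} (ha : ∀ t, 0 < a t)
    (h : Tendsto (fun t i => a t * s t i) l (𝓝 w)) : RankingsConverge l s w :=
  ⟨.of_tendsto (b := 0) ha (by simpa using h), a, ha, h⟩

/-- Parameters close to the limit `t → T-` are positive and less than `T`. -/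
theorem eventually_toLeft {T : ℝ≥0∞} (hT : 0 < T) :
    ∀ᶠ t in toLeft T, 0 < t ∧ ENNReal.ofReal t < T := by
  by_cases h : T = ∞
  · rw [toLeft, if_pos h, h]
    filter_upwards [eventually_gt_atTop 0] with t ht
    exact ⟨ht, ENNReal.ofReal_lt_top⟩
  · rw [toLeft, if_neg h]
    filter_upwards [Ioo_mem_nhdsLT (ENNReal.toReal_pos hT.ne' h)] with t ht
    exact ⟨ht.1, (ENNReal.ofReal_lt_iff_lt_toReal ht.1.le h).mpr ht.2⟩

theorem tendsto_mul_toLeft_div (R : ℝ≥0∞) {ρ : ℝ} (hρ : 0 < ρ) :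
    Tendsto (fun t => t * ρ) (toLeft (R / ENNReal.ofReal ρ)) (toLeft R) := by
  have hρ' : ENNReal.ofReal ρ ≠ 0 := (ENNReal.ofReal_pos.mpr hρ).ne'
  by_cases h : R = ∞
  · rw [h, ENNReal.top_div_of_ne_top ENNReal.ofReal_ne_top, toLeft, if_pos rfl]
    exact tendsto_id.atTop_mul_const hρ
  · rw [toLeft, if_neg (ENNReal.div_ne_top h hρ'), toLeft, if_neg h, ENNReal.toReal_div,
      ENNReal.toReal_ofReal hρ.le]
    refine tendsto_nhdsWithin_iff.mpr ⟨?_, ?_⟩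
    · have h1 : Tendsto (fun t => t * ρ) (𝓝 (R.toReal / ρ)) (𝓝 (R.toReal / ρ * ρ)) :=
        tendsto_id.mul_const ρ
      rw [div_mul_cancel₀ _ hρ.ne'] at h1
      exact h1.mono_left nhdsWithin_le_nhds
    · filter_upwards [self_mem_nhdsWithin] with t ht
      exact (lt_div_iff₀ hρ).mp ht

/-- Averages of a convergent sequence, with weights that individually tend to zero, tend to the
limit of the sequence. -/
theorem tendsto_tsum_weights_mul {p : ℝ → ℕ → ℝ} {u : ℕ → ℝ} {L : ℝ}
    (hp : ∀ᶠ t in l, (∀ k, 0 ≤ p t k) ∧ HasSum (p t) 1)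
    (hp0 : ∀ k, Tendsto (fun t => p t k) l (𝓝 0)) (hu : Tendsto u atTop (𝓝 L)) :
    Tendsto (fun t => ∑' k, p t k * u k) l (𝓝 L) := by
  rw [Metric.tendsto_nhds]
  intro ε hε
  obtain ⟨N, hN⟩ := Metric.tendsto_atTop.mp hu (ε / 2) (half_pos hε)
  have hhead : Tendsto (fun t => ∑ k ∈ Finset.range N, p t k * |u k - L|) l (𝓝 0) := by
    simpa using tendsto_finsetSum (Finset.range N) fun k _ => (hp0 k).mul_const |u k - L|
  filter_upwards [hp, hhead.eventually (gt_mem_nhds (half_pos hε))] with t ⟨hnn, hsum⟩ ht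
  have hmajor : HasSum
      (fun k => (if k ∈ Finset.range N then p t k * |u k - L| else 0) + p t k * (ε / 2))
      ((∑ k ∈ Finset.range N, p t k * |u k - L|) + 1 * (ε / 2)) := by
    refine HasSum.add ?_ (hsum.mul_right _)
    rw [← Finset.sum_congr rfl fun k hk => if_pos hk]
    exact hasSum_sum_of_ne_finset_zero fun k hk => if_neg hk
  have hle : ∀ k, ‖p t k * (u k - L)‖ ≤
      (if k ∈ Finset.range N then p t k * |u k - L| else 0) + p t k * (ε / 2) := by
    intro k
    rw [norm_mul, Real.norm_of_nonneg (hnn k), Real.norm_eq_abs]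
    split_ifs with hk
    · exact le_add_of_nonneg_right (mul_nonneg (hnn k) (half_pos hε).le)
    · rw [zero_add]
      exact mul_le_mul_of_nonneg_left
        (hN k (not_lt.mp fun h => hk (Finset.mem_range.mpr h))).le (hnn k)
  have hdiff : Summable fun k => p t k * (u k - L) :=
    Summable.of_norm_bounded hmajor.summable hle
  have hsplit : ∑' k, p t k * u k = ∑' k, p t k * (u k - L) + L := by
    have h := (hdiff.hasSum.add (hsum.mul_right L)).tsum_eq
    rw [one_mul] at h
    rw [← h]
    exact tsum_congr fun k => by ring
  rw [Real.dist_eq, hsplit, add_sub_cancel_right]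
  have := tsum_of_norm_bounded hmajor hle
  rw [Real.norm_eq_abs] at this
  linarith

end Rankings

/-! ### The power series of a member of the class -/

namespace ClassP

variable (f : ClassP)

theorem summable_coeff_mul_pow {r : ℝ} (hr : 0 ≤ r) (h : ENNReal.ofReal r < f.radius) :
    Summable fun k => f.coeff k * r ^ k := by
  lift r to NNReal using hr
  rw [ENNReal.ofReal_coe_nnreal] at h
  refine (FormalMultilinearSeries.summable_norm_mul_pow _ h).congr fun k => ?_
  rw [FormalMultilinearSeries.ofScalars_norm, Real.norm_of_nonneg (f.coeff_pos k).le]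

theorem coeff_mul_pow_pos {z : ℝ} (hz : 0 < z) (k : ℕ) : 0 < f.coeff k * z ^ k :=
  mul_pos (f.coeff_pos k) (pow_pos hz k)

theorem tsum_pos_of_lt_radius {z : ℝ} (hz : 0 < z) (h : ENNReal.ofReal z < f.radius) :
    0 < ∑' k, f.coeff k * z ^ k :=
  (f.summable_coeff_mul_pow hz.le h).tsum_pos (fun k => (f.coeff_mul_pow_pos hz k).le) 0
    (f.coeff_mul_pow_pos hz 0)

/-- As `z → R_f`, each single term of the series becomes negligible against the sum. For an entire
function the next term already dominates; otherwise the sum tends to infinity. -/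
theorem tendsto_term_div_tsum (hf : f.IsEntire ∨ f.DivergesAtBoundary) (k : ℕ) :
    Tendsto (fun z => f.coeff k * z ^ k / ∑' j, f.coeff j * z ^ j) (toLeft f.radius) (𝓝 0) := by
  have hev := eventually_toLeft (T := f.radius) f.radius_pos
  rcases hf with hf | ⟨hf, hdiv⟩
  · have hlim : Tendsto (fun z : ℝ => f.coeff k / f.coeff (k + 1) * z⁻¹) atTop (𝓝 0) := by
      simpa using tendsto_inv_atTop_zero.const_mul (f.coeff k / f.coeff (k + 1))
    have htop : toLeft f.radius = atTop := if_pos hf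
    rw [htop] at hev ⊢
    refine squeeze_zero' ?_ ?_ hlim
    · filter_upwards [hev] with z hz
      exact (div_pos (f.coeff_mul_pow_pos hz.1 k) (f.tsum_pos_of_lt_radius hz.1 hz.2)).le
    · filter_upwards [hev] with z hz
      have hle : f.coeff (k + 1) * z ^ (k + 1) ≤ ∑' j, f.coeff j * z ^ j :=
        (f.summable_coeff_mul_pow hz.1.le hz.2).le_tsum _
          fun j _ => (f.coeff_mul_pow_pos hz.1 j).le
      calc f.coeff k * z ^ k / ∑' j, f.coeff j * z ^ j
          ≤ f.coeff k * z ^ k / (f.coeff (k + 1) * z ^ (k + 1)) :=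
            div_le_div_of_nonneg_left (f.coeff_mul_pow_pos hz.1 k).le
              (f.coeff_mul_pow_pos hz.1 (k + 1)) hle
        _ = f.coeff k / f.coeff (k + 1) * z⁻¹ := by
            have := hz.1.ne'
            have := (f.coeff_pos (k + 1)).ne'
            field_simp
            ring
  · have hleft : toLeft f.radius = 𝓝[<] f.radius.toReal := if_neg hf
    rw [hleft] at hev ⊢
    have hcont : ∀ k, Tendsto (fun z : ℝ => f.coeff k * z ^ k) (𝓝[<] f.radius.toReal)
        (𝓝 (f.coeff k * f.radius.toReal ^ k)) := fun k =>
      ((continuous_const.mul (continuous_pow k)).tendsto _).mono_left nhdsWithin_le_nhds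
    refine (hcont k).div_atTop (tendsto_atTop.mpr fun b => ?_)
    have hR : 0 < f.radius.toReal := ENNReal.toReal_pos f.radius_pos.ne' hf
    have hN := (not_summable_iff_tendsto_nat_atTop_of_nonneg
      fun k => (f.coeff_mul_pow_pos hR k).le).mp hdiv
    obtain ⟨N, hN⟩ := (hN.eventually_gt_atTop b).exists
    filter_upwards [hev, (tendsto_finsetSum (Finset.range N) fun k _ => hcont k).eventually
      (lt_mem_nhds hN)] with z hz hz'
    exact hz'.le.trans ((f.summable_coeff_mul_pow hz.1.le hz.2).sum_le_tsum _
      fun j _ => (f.coeff_mul_pow_pos hz.1 j).le)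

end ClassP

/-! ### Matrix functions of nonnegative matrices -/

section MatrixFunctions

variable {V : Type*} [Fintype V] [DecidableEq V] (f : ClassP) {M : Matrix V V ℝ}

theorem matrixTerm_smul (t : ℝ) (k : ℕ) :
    f.matrixTerm (t • M) k = (f.coeff k * t ^ k) • M ^ k := by
  rw [ClassP.matrixTerm, smul_pow, smul_smul]

/-- The positive eigenvector bounds the entries of `M ^ k` by multiples of `ρ ^ k`. -/
theorem summable_matrixTerm (hM : ∀ i j, 0 ≤ M i j) {ρ : ℝ} {x : V → ℝ} (hx : ∀ i, 0 < x i)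
    (hMx : M *ᵥ x = ρ • x) {t : ℝ} (ht : 0 < t) (hρ : 0 ≤ ρ)
    (h : ENNReal.ofReal (t * ρ) < f.radius) : Summable (f.matrixTerm (t • M)) := by
  refine Pi.summable.mpr fun i => Pi.summable.mpr fun j => ?_
  refine Summable.of_nonneg_of_le (fun k => ?_) (fun k => ?_)
    ((f.summable_coeff_mul_pow (mul_nonneg ht.le hρ) h).mul_left (x i / x j))
  · rw [matrixTerm_smul]
    exact mul_nonneg (f.coeff_mul_pow_pos ht k).le (pow_entry_nonneg hM k i j)
  · rw [matrixTerm_smul]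
    calc (f.coeff k * t ^ k) * (M ^ k) i j
        ≤ (f.coeff k * t ^ k) * (x i / x j * ρ ^ k) :=
          mul_le_mul_of_nonneg_left (pow_entry_le hM hx hMx k i j) (f.coeff_mul_pow_pos ht k).le
      _ = x i / x j * (f.coeff k * (t * ρ) ^ k) := by ring

theorem ofReal_mul_lt_radius {ρ : ℝ} (hρ : 0 ≤ ρ) (hs : specRadius M = ENNReal.ofReal ρ) {t : ℝ}
    (ht : 0 < t) (h : ENNReal.ofReal t < tStar f M) : ENNReal.ofReal (t * ρ) < f.radius := by
  rcases hρ.eq_or_lt with rfl | hρ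
  · rw [mul_zero, ENNReal.ofReal_zero]
    exact f.radius_pos
  · rw [tStar, hs, ENNReal.lt_div_iff_mul_lt (Or.inl (ENNReal.ofReal_pos.mpr hρ).ne')
      (Or.inl ENNReal.ofReal_ne_top), ← ENNReal.ofReal_mul ht.le] at h
    exact h

theorem tStar_pos {ρ : ℝ} (hs : specRadius M = ENNReal.ofReal ρ) : 0 < tStar f M := by
  rw [tStar, hs]
  exact ENNReal.div_pos f.radius_pos.ne' ENNReal.ofReal_ne_top

theorem summable_matrixTerm_of_lt_tStar [Nonempty V] (hM : ∀ i j, 0 ≤ M i j) {ρ : ℝ} {x : V → ℝ}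
    (hx : ∀ i, 0 < x i) (hMx : M *ᵥ x = ρ • x) {t : ℝ} (ht : 0 < t)
    (h : ENNReal.ofReal t < tStar f M) : Summable (f.matrixTerm (t • M)) :=
  have hρ := eigenvalue_nonneg hM hx hMx
  summable_matrixTerm f hM hx hMx ht hρ
    (ofReal_mul_lt_radius f hρ (specRadius_eq_of_pos_eigenvector hM hx hMx) ht h)

theorem summable_matrixTerm_transpose {t : ℝ} (h : Summable (f.matrixTerm (t • M))) :
    Summable (f.matrixTerm (t • Mᵀ)) := by
  refine h.matrix_transpose.congr fun k => ?_
  rw [matrixTerm_smul, matrixTerm_smul, Matrix.transpose_smul, Matrix.transpose_pow]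

theorem hasSum_broadcast {t : ℝ} (h : Summable (f.matrixTerm (t • M))) (v : V → ℝ) (i : V) :
    HasSum (fun k => f.coeff k * t ^ k * (M ^ k *ᵥ v) i) (broadcast f M v t i) := by
  let φ : Matrix V V ℝ →+ ℝ :=
    { toFun := fun X => (X *ᵥ v) i
      map_zero' := by simp
      map_add' := fun X Y => by simp [Matrix.add_mulVec] }
  have hφ : Continuous φ :=
    (continuous_apply i).comp (Continuous.matrix_mulVec continuous_id continuous_const)
  refine (h.hasSum.map φ hφ).congr_fun fun k => ?_
  change _ = (f.matrixTerm (t • M) k *ᵥ v) i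
  rw [matrixTerm_smul, Matrix.smul_mulVec, Pi.smul_apply, smul_eq_mul]

/-- If the normalised powers of `M` applied to `v` tend to a positive multiple of `x`, then so does
their average with the weights `c_k (t ρ) ^ k / f(t ρ)`, which is `f(t M) v / f(t ρ)`. -/
theorem rankingsConverge_of_tendsto_pow [Nonempty V] (hf : f.IsEntire ∨ f.DivergesAtBoundary)
    (hM : ∀ i j, 0 ≤ M i j) {ρ : ℝ} (hρ : 0 < ρ) {x : V → ℝ} (hx : ∀ i, 0 < x i)
    (hMx : M *ᵥ x = ρ • x) {v : V → ℝ} {κ : ℝ} (hκ : 0 < κ)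
    (hpow : ∀ i, Tendsto (fun k : ℕ => (M ^ k *ᵥ v) i / ρ ^ k) atTop (𝓝 (κ * x i))) :
    RankingsConverge (toLeft (tStar f M)) (broadcast f M v) x := by
  have hs := specRadius_eq_of_pos_eigenvector hM hx hMx
  set F : ℝ → ℝ := fun t => ∑' k, f.coeff k * (t * ρ) ^ k with hF
  have hev : ∀ᶠ t in toLeft (tStar f M), 0 < t ∧ ENNReal.ofReal (t * ρ) < f.radius := by
    filter_upwards [eventually_toLeft (tStar_pos f hs)] with t ht
    exact ⟨ht.1, ofReal_mul_lt_radius f hρ.le hs ht.1 ht.2⟩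
  have hFpos : ∀ᶠ t in toLeft (tStar f M), 0 < F t := by
    filter_upwards [hev] with t ht
    exact f.tsum_pos_of_lt_radius (mul_pos ht.1 hρ) ht.2
  -- The scaling factor has to be positive for every `t`, also where the series diverges.
  refine RankingsConverge.of_tendsto (a := fun t => if 0 < F t then κ⁻¹ * (F t)⁻¹ else 1)
    (fun t => ?_) (tendsto_pi_nhds.mpr fun i => ?_)
  · split_ifs with h
    · positivity
    · exact one_pos
  have havg : Tendsto (fun t => ∑' k, f.coeff k * (t * ρ) ^ k / F t * ((M ^ k *ᵥ v) i / ρ ^ k))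
      (toLeft (tStar f M)) (𝓝 (κ * x i)) := by
    refine tendsto_tsum_weights_mul ?_ (fun k => ?_) (hpow i)
    · filter_upwards [hev, hFpos] with t ht hFt
      refine ⟨fun k => (div_pos (f.coeff_mul_pow_pos (mul_pos ht.1 hρ) k) hFt).le, ?_⟩
      have := (f.summable_coeff_mul_pow (mul_pos ht.1 hρ).le ht.2).hasSum.div_const (F t)
      rwa [div_self hFt.ne'] at this
    · have hlim := tendsto_mul_toLeft_div f.radius hρ
      rw [← hs] at hlim
      exact (f.tendsto_term_div_tsum hf k).comp hlim
  have hlim := havg.const_mul κ⁻¹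
  rw [inv_mul_cancel_left₀ hκ.ne'] at hlim
  refine hlim.congr' ?_
  filter_upwards [hev, hFpos] with t ht hFt
  rw [if_pos hFt, mul_assoc, ← (hasSum_broadcast f
    (summable_matrixTerm f hM hx hMx ht.1 hρ.le ht.2) v i).tsum_eq, ← tsum_mul_left (a := (F t)⁻¹)]
  congr 1
  refine tsum_congr fun k => ?_
  have := pow_pos hρ k
  rw [mul_pow]
  field_simp

/-- To first order in `t`, `f(t M) 1` is `c₀ + c₁ t M 1`. -/
theorem rankingsConvergeAffine_rowSums [Nonempty V] (hM : ∀ i j, 0 ≤ M i j) {ρ : ℝ} {x : V → ℝ}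
    (hx : ∀ i, 0 < x i) (hMx : M *ᵥ x = ρ • x) :
    RankingsConvergeAffine (𝓝[>] 0) (broadcast f M 1) (M *ᵥ 1) := by
  have hρ := eigenvalue_nonneg hM hx hMx
  have hs := specRadius_eq_of_pos_eigenvector hM hx hMx
  obtain ⟨t₀, ht₀, ht₀'⟩ : ∃ t₀ : ℝ, 0 < t₀ ∧ ENNReal.ofReal t₀ < tStar f M := by
    obtain ⟨r, hr, hr'⟩ := ENNReal.lt_iff_exists_nnreal_btwn.mp (tStar_pos f hs)
    exact ⟨r, by exact_mod_cast hr, by simpa using hr'⟩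
  have hsum : ∀ t, 0 < t → t ≤ t₀ → ∀ i, HasSum
      (fun k => f.coeff k * t ^ k * (M ^ k *ᵥ 1) i) (broadcast f M 1 t i) := fun t ht htt i =>
    hasSum_broadcast f (summable_matrixTerm_of_lt_tStar f hM hx hMx ht
      ((ENNReal.ofReal_le_ofReal htt).trans_lt ht₀')) 1 i
  have hc := f.coeff_pos 1
  have hnn : ∀ k i, 0 ≤ (M ^ k *ᵥ 1) i := fun k i =>
    Finset.sum_nonneg fun j _ => mul_nonneg (pow_entry_nonneg hM k i j) zero_le_one
  refine RankingsConvergeAffine.of_tendsto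
    (a := fun t => if 0 < t then (f.coeff 1 * t)⁻¹ else 1)
    (b := fun t => -(f.coeff 0 * (f.coeff 1 * t)⁻¹)) (fun t => ?_)
    (tendsto_pi_nhds.mpr fun i => ?_)
  · split_ifs with h
    · positivity
    · exact one_pos
  have htail : ∀ t, 0 < t → t ≤ t₀ → HasSum
      (fun k => f.coeff (k + 1) * t ^ k * (M ^ (k + 1) *ᵥ 1) i)
      ((broadcast f M 1 t i - f.coeff 0) / t) := by
    intro t ht htt
    have h := ((hasSum_nat_add_iff' 1).mpr (hsum t ht htt i)).div_const t
    simp only [Finset.sum_range_one, pow_zero, mul_one, Matrix.one_mulVec, Pi.one_apply] at h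
    refine h.congr_fun fun k => ?_
    field_simp
    ring
  have hzero : ∑' k, f.coeff (k + 1) * (0 : ℝ) ^ k * (M ^ (k + 1) *ᵥ 1) i =
      f.coeff 1 * (M *ᵥ 1) i := by
    rw [tsum_eq_single 0 fun k hk => by simp [hk]]
    simp
  have hlim : Tendsto (fun t : ℝ => ∑' k, f.coeff (k + 1) * t ^ k * (M ^ (k + 1) *ᵥ 1) i)
      (𝓝[>] 0) (𝓝 (f.coeff 1 * (M *ᵥ 1) i)) := by
    rw [← hzero]
    refine tendsto_tsum_of_dominated_convergence (htail t₀ ht₀ le_rfl).summable (fun k => ?_) ?_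
    · have : Continuous fun t : ℝ => f.coeff (k + 1) * t ^ k * (M ^ (k + 1) *ᵥ 1) i := by
        fun_prop
      exact (this.tendsto 0).mono_left nhdsWithin_le_nhds
    · filter_upwards [Ioo_mem_nhdsGT ht₀] with t ht k
      have ht0 := ht.1.le
      have hck := (f.coeff_pos (k + 1)).le
      rw [Real.norm_of_nonneg (mul_nonneg (mul_nonneg hck (pow_nonneg ht0 k)) (hnn _ i))]
      gcongr
      · exact hnn _ i
      · exact ht.2.le
  have hlim' := hlim.const_mul (f.coeff 1)⁻¹
  rw [inv_mul_cancel_left₀ hc.ne'] at hlim'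
  refine hlim'.congr' ?_
  filter_upwards [Ioo_mem_nhdsGT ht₀] with t ht
  have ht0 := ht.1
  rw [(htail t ht.1 ht.2.le).tsum_eq, if_pos ht.1]
  field_simp
  ring

end MatrixFunctions

/-! ### Strongly connected digraphs -/

section Digraphs

variable {V : Type*} (G : Digraph V)

theorem StronglyConnected.nonnegIrreducible {G : Digraph V} (hG : StronglyConnected G) :
    NonnegIrreducible (adjMatrix G) := by
  refine ⟨fun i j => ?_, fun i j => Relation.ReflTransGen.mono (fun a b hab => ?_) _ _ (hG i j)⟩
  · rw [adjMatrix, Matrix.of_apply]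
    split_ifs <;> norm_num
  · simp [adjMatrix, hab]

theorem adjMatrix_mulVec_one [Fintype V] :
    adjMatrix G *ᵥ 1 = fun i => (outDegree G i : ℝ) := by
  classical
  ext i
  simp [adjMatrix, Matrix.mulVec, dotProduct, outDegree, Set.ncard_eq_toFinset_card']

theorem adjMatrix_transpose_mulVec_one [Fintype V] :
    (adjMatrix G)ᵀ *ᵥ 1 = fun i => (inDegree G i : ℝ) := by
  classical
  ext i
  simp [adjMatrix, Matrix.mulVec, dotProduct, inDegree, Set.ncard_eq_toFinset_card']

end Digraphs

/-! ### Dominant eigenvectors of irreducible matrices -/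

section Dominant

variable {V : Type*} [Fintype V] [DecidableEq V] {A : Matrix V V ℝ}

theorem isDominantRight_of_eigenvector [Nonempty V] (hA : ∀ i j, 0 ≤ A i j) {ρ : ℝ} {x : V → ℝ}
    (hx : ∀ i, 0 < x i) (hAx : A *ᵥ x = ρ • x) : IsDominantRight A x := by
  refine ⟨hx, ?_⟩
  rw [specRadius_eq_of_pos_eigenvector hA hx hAx,
    ENNReal.toReal_ofReal (eigenvalue_nonneg hA hx hAx), hAx]

theorem NonnegIrreducible.exists_isDominantRight [Nonempty V] (hA : NonnegIrreducible A) :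
    ∃ x, IsDominantRight A x :=
  let ⟨_, x, hx, hAx⟩ := hA.exists_pos_eigenvector
  ⟨x, isDominantRight_of_eigenvector hA.nonneg hx hAx⟩

theorem isDominantRight_transpose {y : V → ℝ} : IsDominantRight Aᵀ y ↔ IsDominantLeft A y := by
  rw [IsDominantRight, IsDominantLeft, specRadius_transpose, Matrix.mulVec_transpose]

theorem PrimitiveMatrix.transpose (hA : PrimitiveMatrix A) : PrimitiveMatrix Aᵀ := by
  obtain ⟨h, r, s, hr, hs⟩ := hA
  refine ⟨fun i j => h j i, r, s, ?_, hs⟩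
  rw [Matrix.transpose_map, Matrix.charpoly_transpose, hr]

/-- Since `r` is an eigenvalue, `r ≤ ρ`, so that no member of `s` has modulus `ρ`; hence `ρ` and
every other eigenvalue of modulus `ρ` equal `r`. -/
theorem PrimitiveMatrix.eigenvalue_eq [Nonempty V] (hA : PrimitiveMatrix A) {ρ : ℝ} {x : V → ℝ}
    (hx : ∀ i, 0 < x i) (hAx : A *ᵥ x = ρ • x) {μ : ℂ} {z : V → ℂ} (hz : z ≠ 0)
    (hAz : A.map (algebraMap ℝ ℂ) *ᵥ z = μ • z) (hμ : ‖μ‖ = ρ) : μ = ρ := by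
  obtain ⟨h, r, s, hr, hs⟩ := hA
  have hroot : ∀ {ν : ℂ}, ν ∈ spectrum ℂ (A.map (algebraMap ℝ ℂ)) ↔ ν = r ∨ ν ∈ s := by
    intro ν
    rw [Matrix.mem_spectrum_iff_isRoot_charpoly, ← Multiset.mem_cons, ← hr,
      Polynomial.mem_roots (Matrix.charpoly_monic _).ne_zero]
  have hrρ : r ≤ ρ := by
    obtain ⟨z', hz', hAz'⟩ := mem_spectrum_iff_exists_mulVec.mp (hroot.mpr (Or.inl rfl))
    have := norm_eigenvalue_le h hx hAx hz' hAz'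
    rw [Complex.norm_real] at this
    exact (le_abs_self r).trans this
  have hlarge : ∀ ν : ℂ, ν ∈ spectrum ℂ (A.map (algebraMap ℝ ℂ)) → ‖ν‖ = ρ → ν = r := by
    intro ν hν hνρ
    refine (hroot.mp hν).resolve_right fun hmem => ?_
    have := hs ν hmem
    linarith
  have hρ : (ρ : ℂ) = r := by
    refine hlarge ρ (mem_spectrum_iff_exists_mulVec.mpr ⟨fun i => (x i : ℂ), ?_, ?_⟩) ?_
    · obtain ⟨i⟩ := ‹Nonempty V›
      exact Function.ne_iff.mpr ⟨i, by simpa using (hx i).ne'⟩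
    · rw [map_mulVec_ofReal, hAx]
      ext i
      simp
    · rw [Complex.norm_real, Real.norm_of_nonneg (eigenvalue_nonneg h hx hAx)]
  rw [hρ]
  exact hlarge μ (mem_spectrum_iff_exists_mulVec.mpr ⟨z, hz, hAz⟩) hμ

/-- Equality in the triangle inequality: since `ε > 0`, a convex combination of `α` and `1` has the
largest possible modulus only if `α` is the nonnegative real `ρ`. -/
theorem eq_ofReal_of_norm_convex_comb {α : ℂ} {ρ ε : ℝ} (hε : 0 < ε) (hε1 : ε < 1)
    (hα : ‖α‖ ≤ ρ) (h : ‖(1 - ε : ℂ) * α + ε‖ = (1 - ε) * ρ + ε) : α = ρ := by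
  have hre : α.re ≤ ρ := (Complex.re_le_norm α).trans hα
  have hsq : α.re * α.re + α.im * α.im ≤ ρ ^ 2 := by
    rw [← Complex.normSq_apply, ← Complex.sq_norm]
    exact pow_le_pow_left₀ (norm_nonneg α) hα 2
  have hnorm : ((1 - ε) * α.re + ε) ^ 2 + ((1 - ε) * α.im) ^ 2 = ((1 - ε) * ρ + ε) ^ 2 := by
    rw [← h, Complex.sq_norm, Complex.normSq_apply]
    simp
    ring
  have hdiff : (1 - ε) ^ 2 * (ρ ^ 2 - (α.re * α.re + α.im * α.im)) +
      2 * (ε * (1 - ε)) * (ρ - α.re) = 0 := by linarith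
  have hε' : 0 < ε * (1 - ε) := mul_pos hε (sub_pos.mpr hε1)
  have hρre : α.re = ρ := by
    refine le_antisymm hre ?_
    have h1 : 0 ≤ (1 - ε) ^ 2 * (ρ ^ 2 - (α.re * α.re + α.im * α.im)) :=
      mul_nonneg (sq_nonneg _) (sub_nonneg.mpr hsq)
    by_contra hlt
    have h2 : 0 < 2 * (ε * (1 - ε)) * (ρ - α.re) :=
      mul_pos (mul_pos two_pos hε') (sub_pos.mpr (not_le.mp hlt))
    linarith
  have him : α.im = 0 := by
    rw [hρre] at hsq
    exact mul_self_eq_zero.mp (le_antisymm (by linarith) (mul_self_nonneg _))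
  exact Complex.ext hρre him

/-- A real eigenvector of `A` is one of `(1 - ε) A + ε I`. -/
theorem lazy_mulVec {ε ρ : ℝ} {x : V → ℝ} (hAx : A *ᵥ x = ρ • x) :
    ((1 - ε) • A + ε • (1 : Matrix V V ℝ)) *ᵥ x = ((1 - ε) * ρ + ε) • x := by
  rw [Matrix.add_mulVec, Matrix.smul_mulVec, Matrix.smul_mulVec, Matrix.one_mulVec, hAx, smul_smul,
    add_smul]

theorem lazy_nonneg {V : Type*} [DecidableEq V] {A : Matrix V V ℝ} (hA : ∀ i j, 0 ≤ A i j)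
    {ε : ℝ} (hε : 0 < ε) (hε1 : ε < 1) (i j : V) :
    0 ≤ ((1 - ε) • A + ε • (1 : Matrix V V ℝ)) i j := by
  have h1 : (0 : ℝ) ≤ (1 : Matrix V V ℝ) i j := by
    rw [Matrix.one_apply]
    split_ifs <;> norm_num
  exact add_nonneg (mul_nonneg (sub_pos.mpr hε1).le (hA i j)) (mul_nonneg hε.le h1)

/-- The eigenvectors of `(1 - ε) A + ε I` are those of `A`. -/
theorem eigenvector_of_lazy {ε : ℝ} (hε1 : ε < 1) {μ : ℂ} {z : V → ℂ}
    (h : ((1 - ε) • A + ε • (1 : Matrix V V ℝ)).map (algebraMap ℝ ℂ) *ᵥ z = μ • z) :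
    A.map (algebraMap ℝ ℂ) *ᵥ z = ((μ - ε) / (1 - ε)) • z := by
  have hne : (1 - ε : ℂ) ≠ 0 := by exact_mod_cast (sub_pos.mpr hε1).ne'
  have hmap : ((1 - ε) • A + ε • (1 : Matrix V V ℝ)).map (algebraMap ℝ ℂ) =
      (1 - ε : ℂ) • A.map (algebraMap ℝ ℂ) + (ε : ℂ) • (1 : Matrix V V ℂ) := by
    ext i j
    by_cases hij : i = j <;> simp [hij]
  rw [hmap, Matrix.add_mulVec, Matrix.smul_mulVec, Matrix.smul_mulVec, Matrix.one_mulVec] at h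
  ext i
  have hi := congrFun h i
  simp only [Pi.add_apply, Pi.smul_apply, smul_eq_mul] at hi ⊢
  field_simp
  linear_combination hi

/-- For spectral radius zero the matrix vanishes and there is only one node. -/
theorem NonnegIrreducible.rankingsConverge_of_eigenvalue_zero [Nonempty V] (f : ClassP)
    (hA : NonnegIrreducible A) {x : V → ℝ} (hx : ∀ i, 0 < x i) (hAx : A *ᵥ x = (0 : ℝ) • x)
    {v : V → ℝ} (hv : ∀ i, 0 < v i) (l : Filter ℝ) : RankingsConverge l (broadcast f A v) x := by
  have hA0 : A = 0 := by
    ext i j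
    have h : ∑ k, A i k * x k = 0 := by
      simpa [Matrix.mulVec, dotProduct] using congrFun hAx i
    have := (Finset.sum_eq_zero_iff_of_nonneg
      fun k _ => mul_nonneg (hA.nonneg i k) (hx k).le).mp h j (Finset.mem_univ j)
    exact (mul_eq_zero.mp this).resolve_right (hx j).ne'
  have hsub : ∀ i j : V, i = j := fun i j => by
    induction hA.connected i j with
    | refl => rfl
    | tail _ h _ => simp [hA0] at h
  have hb : ∀ t i, broadcast f A v t i = f.coeff 0 * v i := by
    intro t i
    have : f.matrixFun (t • A) = f.coeff 0 • 1 := by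
      rw [ClassP.matrixFun, tsum_eq_single 0 fun k hk => by
        rw [matrixTerm_smul, hA0, zero_pow hk, smul_zero],
        ClassP.matrixTerm, pow_zero]
    rw [broadcast, this, Matrix.smul_mulVec, Matrix.one_mulVec, Pi.smul_apply, smul_eq_mul]
  obtain ⟨i₀⟩ := ‹Nonempty V›
  have hc := f.coeff_pos 0
  refine RankingsConverge.of_tendsto (a := fun _ => x i₀ / (f.coeff 0 * v i₀))
    (fun _ => div_pos (hx i₀) (mul_pos hc (hv i₀))) ?_
  refine tendsto_const_nhds.congr fun t => funext fun i => ?_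
  rw [hb, hsub i i₀, div_mul_cancel₀ _ (mul_pos hc (hv i₀)).ne']

/-- Limits of rankings when every eigenvector for an eigenvalue of modulus `ρ` is a multiple of the
positive eigenvector `x`. -/
theorem rankingsConverge_of_peripheral [Nonempty V] (f : ClassP)
    (hf : f.IsEntire ∨ f.DivergesAtBoundary) {M : Matrix V V ℝ} (hM : ∀ i j, 0 ≤ M i j) {ρ : ℝ}
    (hρ : 0 < ρ) {x y : V → ℝ} (hx : ∀ i, 0 < x i) (hy : ∀ i, 0 < y i) (hMx : M *ᵥ x = ρ • x)
    (hMy : y ᵥ* M = ρ • y)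
    (hsimple : ∀ (μ : ℂ) (z : V → ℂ), ‖μ‖ = ρ → M.map (algebraMap ℝ ℂ) *ᵥ z = μ • z →
      ∃ c : ℂ, z = fun i => c * (x i : ℂ)) {v : V → ℝ} (hv : ∀ i, 0 < v i) :
    RankingsConverge (toLeft (tStar f M)) (broadcast f M v) x := by
  have hpos : ∀ u : V → ℝ, (∀ i, 0 < u i) → 0 < y ⬝ᵥ u := fun u hu =>
    Finset.sum_pos (fun i _ => mul_pos (hy i) (hu i)) Finset.univ_nonempty
  exact rankingsConverge_of_tendsto_pow f hf hM hρ hx hMx (div_pos (hpos v hv) (hpos x hx))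
    (tendsto_pow_mulVec_div hM hρ hx hy hMx hMy hsimple v)

/-- Every dominant right eigenvector `x` of `A` is one of `M`. The positive left eigenvector, needed
for the limit of the powers, is obtained from the transpose. -/
theorem NonnegIrreducible.rankingsConverge_dominant [Nonempty V] (f : ClassP)
    (hf : f.IsEntire ∨ f.DivergesAtBoundary) (hA : NonnegIrreducible A) {M : Matrix V V ℝ}
    (hM : (M = A ∧ PrimitiveMatrix A) ∨
      ∃ ε : ℝ, 0 < ε ∧ ε < 1 ∧ M = (1 - ε) • A + ε • (1 : Matrix V V ℝ))
    {x : V → ℝ} (hx : IsDominantRight A x) {v : V → ℝ} (hv : ∀ i, 0 < v i) :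
    RankingsConverge (toLeft (tStar f M)) (broadcast f M v) x := by
  obtain ⟨y, hy⟩ := hA.transpose.exists_isDominantRight
  rw [isDominantRight_transpose] at hy
  obtain ⟨hx, hAx⟩ := hx
  obtain ⟨hy, hAy⟩ := hy
  generalize (specRadius A).toReal = ρ at hAx hAy
  have hρ := eigenvalue_nonneg hA.nonneg hx hAx
  rcases hM with ⟨rfl, hprim⟩ | ⟨ε, hε, hε1, rfl⟩
  · rcases hρ.eq_or_lt with rfl | hρ
    · exact hA.rankingsConverge_of_eigenvalue_zero f hx hAx hv _
    refine rankingsConverge_of_peripheral f hf hA.nonneg hρ hx hy hAx hAy (fun μ z hμ hz => ?_) hv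
    by_cases hz0 : z = 0
    · exact ⟨0, by simpa [funext_iff] using hz0⟩
    rw [hprim.eigenvalue_eq hx hAx hz0 hz hμ] at hz
    exact hA.eigenvector_unique_complex hx hAx hz
  · have hρ' : 0 < (1 - ε) * ρ + ε :=
      add_pos_of_nonneg_of_pos (mul_nonneg (sub_pos.mpr hε1).le hρ) hε
    have hAy' : y ᵥ* ((1 - ε) • A + ε • (1 : Matrix V V ℝ)) = ((1 - ε) * ρ + ε) • y := by
      rw [Matrix.vecMul_add, Matrix.vecMul_smul, Matrix.vecMul_smul, Matrix.vecMul_one, hAy,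
        smul_smul, add_smul]
    refine rankingsConverge_of_peripheral f hf (lazy_nonneg hA.nonneg hε hε1) hρ' hx hy
      (lazy_mulVec hAx) hAy' (fun μ z hμ hz => ?_) hv
    by_cases hz0 : z = 0
    · exact ⟨0, by simpa [funext_iff] using hz0⟩
    have hAz := eigenvector_of_lazy hε1 hz
    have hne : (1 - ε : ℂ) ≠ 0 := by exact_mod_cast (sub_pos.mpr hε1).ne'
    have hcomb : (1 - ε : ℂ) * ((μ - ε) / (1 - ε)) + ε = μ := by
      field_simp
      ring
    rw [eq_ofReal_of_norm_convex_comb hε hε1 (norm_eigenvalue_le hA.nonneg hx hAx hz0 hAz)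
      (by rw [hcomb, hμ])] at hAz
    exact hA.eigenvector_unique_complex hx hAx hAz

end Dominant

end FCentrality

/-! ### Rankings by total communicability -/

open FCentrality

theorem theorem5p4 {V : Type*} [Fintype V] [DecidableEq V] [Nonempty V]
    (G : Digraph V) (hG : FCentrality.StronglyConnected G) (f : FCentrality.ClassP)
    (A : Matrix V V ℝ) (hA : A = FCentrality.adjMatrix G) :
    -- `f(tA)` and `f(tAᵀ)` are defined for `0 < t < t*`
    (∀ t : ℝ, 0 < t → ENNReal.ofReal t < FCentrality.tStar f A →
      Summable (f.matrixTerm (t • A)) ∧ Summable (f.matrixTerm (t • Aᵀ))) ∧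
    -- the limit `t → 0+`: out-degrees and in-degrees
    FCentrality.RankingsConvergeAffine (𝓝[>] 0) (FCentrality.broadcast f A 1)
      (fun i => (FCentrality.outDegree G i : ℝ)) ∧
    FCentrality.RankingsConvergeAffine (𝓝[>] 0) (FCentrality.receive f A 1)
      (fun i => (FCentrality.inDegree G i : ℝ)) ∧
    -- the dominant eigenvectors exist
    (∃ x₁, FCentrality.IsDominantRight A x₁) ∧ (∃ y₁, FCentrality.IsDominantLeft A y₁) ∧
    -- the limit `t → t*-`, for `A` itself when it is primitive, and in every case for the
    -- primitive matrices `(1 - ε) A + ε I`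
    (f.IsEntire ∨ f.DivergesAtBoundary →
      ∀ M : Matrix V V ℝ,
        (M = A ∧ FCentrality.PrimitiveMatrix A) ∨
          (∃ ε : ℝ, 0 < ε ∧ ε < 1 ∧ M = (1 - ε) • A + ε • (1 : Matrix V V ℝ)) →
        (∀ t : ℝ, 0 < t → ENNReal.ofReal t < FCentrality.tStar f M →
          Summable (f.matrixTerm (t • M)) ∧ Summable (f.matrixTerm (t • Mᵀ))) ∧
        (∀ x₁, FCentrality.IsDominantRight A x₁ →
          FCentrality.RankingsConverge (FCentrality.toLeft (FCentrality.tStar f M))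
            (FCentrality.broadcast f M 1) x₁) ∧
        (∀ y₁, FCentrality.IsDominantLeft A y₁ →
          FCentrality.RankingsConverge (FCentrality.toLeft (FCentrality.tStar f M))
            (FCentrality.receive f M 1) y₁) ∧
        (∀ v : V → ℝ, (∀ i, 0 < v i) →
          (∀ x₁, FCentrality.IsDominantRight A x₁ →
            FCentrality.RankingsConverge (FCentrality.toLeft (FCentrality.tStar f M))
              (FCentrality.broadcast f M v) x₁) ∧
          (∀ y₁, FCentrality.IsDominantLeft A y₁ →
            FCentrality.RankingsConverge (FCentrality.toLeft (FCentrality.tStar f M))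
              (FCentrality.receive f M v) y₁))) := by
  have hirr : NonnegIrreducible A := hA ▸ hG.nonnegIrreducible
  obtain ⟨x, hx⟩ := hirr.exists_isDominantRight
  obtain ⟨y, hy⟩ := hirr.transpose.exists_isDominantRight
  have hsum : ∀ {M : Matrix V V ℝ} {σ : ℝ}, (∀ i j, 0 ≤ M i j) → M *ᵥ x = σ • x → ∀ t : ℝ,
      0 < t → ENNReal.ofReal t < tStar f M →
        Summable (f.matrixTerm (t • M)) ∧ Summable (f.matrixTerm (t • Mᵀ)) :=
    fun hM hMx t ht h =>
      have hs := summable_matrixTerm_of_lt_tStar f hM hx.1 hMx ht h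
      ⟨hs, summable_matrixTerm_transpose f hs⟩
  refine ⟨hsum hirr.nonneg hx.2, ?_, ?_, ⟨x, hx⟩, ⟨y, isDominantRight_transpose.mp hy⟩, ?_⟩
  · rw [← adjMatrix_mulVec_one, ← hA]
    exact rankingsConvergeAffine_rowSums f hirr.nonneg hx.1 hx.2
  · rw [← adjMatrix_transpose_mulVec_one, ← hA]
    exact rankingsConvergeAffine_rowSums f hirr.transpose.nonneg hy.1 hy.2
  intro hf M hM
  have hright : ∀ v : V → ℝ, (∀ i, 0 < v i) → ∀ x₁, IsDominantRight A x₁ →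
      RankingsConverge (toLeft (tStar f M)) (broadcast f M v) x₁ := fun v hv x₁ hx₁ =>
    hirr.rankingsConverge_dominant f hf hM hx₁ hv
  have hleft : ∀ v : V → ℝ, (∀ i, 0 < v i) → ∀ y₁, IsDominantLeft A y₁ →
      RankingsConverge (toLeft (tStar f M)) (receive f M v) y₁ := by
    intro v hv y₁ hy₁
    have hMT : (Mᵀ = Aᵀ ∧ PrimitiveMatrix Aᵀ) ∨
        ∃ ε : ℝ, 0 < ε ∧ ε < 1 ∧ Mᵀ = (1 - ε) • Aᵀ + ε • (1 : Matrix V V ℝ) := by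
      rcases hM with ⟨rfl, hprim⟩ | ⟨ε, hε, hε1, rfl⟩
      · exact Or.inl ⟨rfl, hprim.transpose⟩
      · exact Or.inr ⟨ε, hε, hε1, by simp⟩
    have h := hirr.transpose.rankingsConverge_dominant f hf hMT
      (isDominantRight_transpose.mpr hy₁) hv
    rwa [tStar, specRadius_transpose] at h
  refine ⟨?_, hright 1 fun _ => one_pos, hleft 1 fun _ => one_pos, fun v hv =>
    ⟨hright v hv, hleft v hv⟩⟩
  rcases hM with ⟨rfl, -⟩ | ⟨ε, hε, hε1, rfl⟩
  · exact hsum hirr.nonneg hx.2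
  · exact hsum (lazy_nonneg hirr.nonneg hε hε1) (lazy_mulVec hx.2)
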